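/- Let $\mathcal H\neq\{0\}$ be a complex Hilbert space, let $B(\mathcal H)$ be the algebra of all bounded linear operators on $\mathcal H$, and let $G\in B(\mathcal H)$. Call a linear map $\varphi:B(\mathcal H)\to B(\mathcal H)$ (not assumed to be continuous) a derivation if $\varphi(ST)=\varphi(S)T+S\varphi(T)$ for all $S,T\in B(\mathcal H)$, and derivable at $G$ if $\varphi(ST)=\varphi(S)T+S\varphi(T)$ for all $S,T\in B(\mathcal H)$ with $ST=G$. Call $G$ an all-derivable point of $B(\mathcal H)$ if every linear map $\varphi:B(\mathcal H)\to B(\mathcal H)$ that is derivable at $G$ is a derivation. Then $G$ is an all-derivable point of $B(\mathcal H)$ if and only if $G\neq 0$. Moreover, if $G\neq 0$, then every linear map $\varphi:B(\mathcal H)\to B(\mathcal H)$ that is derivable at $G$ is an inner derivation, that is, there is $D\in B(\mathcal H)$ with $\varphi(X)=XD-DX$ for all $X\in B(\mathcal H)$. -/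

import Mathlib

namespace DerivablePoint

variable {𝕜 A : Type*} [CommSemiring 𝕜] [Ring A] [Algebra 𝕜 A]

/-- A linear map `φ` on an algebra is a derivation if `φ (ST) = φ(S) T + S φ(T)` for all `S, T`.
(Mathlib's `Derivation` is for commutative algebras only.) -/
def IsDerivation (φ : A →ₗ[𝕜] A) : Prop :=
  ∀ S T : A, φ (S * T) = φ S * T + S * φ T

/-- `φ` is derivable at `G` if the Leibniz rule holds for all `S, T` with `ST = G`. -/
def IsDerivableAt (φ : A →ₗ[𝕜] A) (G : A) : Prop :=
  ∀ S T : A, S * T = G → φ (S * T) = φ S * T + S * φ T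

/-- `φ` is the inner derivation `X ↦ X D - D X` for some `D` in the algebra. -/
def IsInnerDerivation (φ : A →ₗ[𝕜] A) : Prop :=
  ∃ D : A, ∀ X : A, φ X = X * D - D * X

variable (𝕜) in
/-- `G` is an all-derivable point if every linear map derivable at `G` is a derivation. -/
def IsAllDerivablePoint (G : A) : Prop :=
  ∀ φ : A →ₗ[𝕜] A, IsDerivableAt φ G → IsDerivation φ

end DerivablePoint

/-! Let f(S,T) = ψ(ST) − ψ(S)T − Sψ(T) with ψ(X) = φ(X) − φ(1)X. For an idempotent P with
(1+sP)(1−uP) = 1, every factorization G = ST yields G = S(1+sP)·(1−uP)T. Hence P, and so any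
finite-rank operator, may cross from S to T (`bilin_balanced`). Doing this twice from 1·G and G·1
makes f antisymmetric on finite-rank operators, up to multiplication by G on either side. As f is
also a Hochschild cocycle, it vanishes there (`IsDerivableAt.leibnizDefect_eq_zero`). For rank at
least two, the proof uses Brešar's identity if G has dense range, and otherwise a vector orthogonal
to the range; rank one is separate. So ψ is X ↦ XD − DX on finite-rank operators, with D bounded by
the closed graph theorem. Subtracting this inner derivation from φ leaves a map that kills all
invertible operators, hence everything (`IsDerivableAt.eq_zero`). -/

namespace DerivablePoint

/-! ### Moving idempotents across factorizations of G -/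

section Algebra

variable {A : Type*} [Ring A] [Algebra ℂ A]

/-- If a bilinear map is constant on the factorizations of `G`, idempotents can be moved from one
argument to the other. -/
theorem bilin_balanced_of_isIdempotentElem {M : Type*} [AddCommGroup M] [Module ℂ M]
    (B : A →ₗ[ℂ] A →ₗ[ℂ] M) {G : A} {m : M} (hB : ∀ S T, S * T = G → B S T = m)
    {P S T : A} (hP : IsIdempotentElem P) (h : S * T = G) : B (S * P) T = B S (P * T) := by
  have key : ∀ s u : ℂ, s - u - s * u = 0 →
      B S T + s • B (S * P) T - u • B S (P * T) - (s * u) • B (S * P) (P * T) = m := by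
    intro s u hsu
    have hmul : (S + s • (S * P)) * (T - u • (P * T)) = G := by
      have : S * P * (P * T) = S * (P * T) := by
        rw [mul_assoc, ← mul_assoc P P, hP.eq]
      calc (S + s • (S * P)) * (T - u • (P * T))
          = S * T + (s - u - s * u) • (S * (P * T)) := by
            simp only [add_mul, mul_sub, smul_mul_assoc, mul_smul_comm, this, mul_assoc]
            module
        _ = G := by rw [hsu, zero_smul, add_zero, h]
    rw [← hB _ _ hmul]
    simp only [map_add, map_sub, map_smul, LinearMap.add_apply, LinearMap.smul_apply]
    module
  -- In 8·(first) + (second) the s·u coefficients 1/2 and −4 cancel, while those of s and u both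
  -- become 6.
  have h1 := key 1 (1 / 2) (by norm_num)
  have h2 := key (-2) 2 (by norm_num)
  rw [← hB S T h] at h1 h2
  rw [← sub_eq_zero] at h1 h2
  have h3 : (6 : ℂ) • (B (S * P) T - B S (P * T)) = 0 := by
    have h4 := congr_arg₂ (fun x y => (8 : ℂ) • x + y) h1 h2
    simp only [smul_zero, add_zero] at h4
    rw [← h4]
    module
  exact sub_eq_zero.1 ((smul_eq_zero.1 h3).resolve_left (by norm_num))

theorem bilin_balanced {M : Type*} [AddCommGroup M] [Module ℂ M]
    (B : A →ₗ[ℂ] A →ₗ[ℂ] M) {G : A} {m : M} (hB : ∀ S T, S * T = G → B S T = m)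
    {X S T : A} (hX : X ∈ Submodule.span ℂ {P : A | IsIdempotentElem P}) (h : S * T = G) :
    B (S * X) T = B S (X * T) := by
  induction hX using Submodule.span_induction with
  | mem P hP => exact bilin_balanced_of_isIdempotentElem B hB hP h
  | zero => simp
  | add X Y _ _ hX hY => simp [mul_add, add_mul, hX, hY]
  | smul a X _ hX => simp [hX]

/-! ### The Leibniz defect as a cocycle -/

/-- The failure of the Leibniz rule. -/
def leibnizDefect (φ : A →ₗ[ℂ] A) (S T : A) : A := φ (S * T) - φ S * T - S * φ T

variable (φ : A →ₗ[ℂ] A)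

/-- Up to sign the defect is the Hochschild coboundary of φ, so its own coboundary vanishes. -/
theorem leibnizDefect_cocycle (S T U : A) :
    S * leibnizDefect φ T U + leibnizDefect φ S (T * U) =
      leibnizDefect φ (S * T) U + leibnizDefect φ S T * U := by
  simp only [leibnizDefect, mul_assoc, mul_sub, sub_mul]
  abel

@[simp] theorem leibnizDefect_zero_left (T : A) : leibnizDefect φ 0 T = 0 := by
  simp [leibnizDefect]

@[simp] theorem leibnizDefect_zero_right (S : A) : leibnizDefect φ S 0 = 0 := by
  simp [leibnizDefect]

theorem leibnizDefect_add_left (S S' T : A) :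
    leibnizDefect φ (S + S') T = leibnizDefect φ S T + leibnizDefect φ S' T := by
  simp only [leibnizDefect, add_mul, map_add]
  abel

theorem leibnizDefect_add_right (S T T' : A) :
    leibnizDefect φ S (T + T') = leibnizDefect φ S T + leibnizDefect φ S T' := by
  simp only [leibnizDefect, mul_add, map_add]
  abel

theorem leibnizDefect_smul_left (a : ℂ) (S T : A) :
    leibnizDefect φ (a • S) T = a • leibnizDefect φ S T := by
  simp only [leibnizDefect, smul_mul_assoc, map_smul, smul_sub]

theorem leibnizDefect_smul_right (a : ℂ) (S T : A) :
    leibnizDefect φ S (a • T) = a • leibnizDefect φ S T := by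
  simp only [leibnizDefect, mul_smul_comm, map_smul, smul_sub]

/-- The identity of Brešar for maps satisfying the Jordan form of the Leibniz rule. -/
theorem leibnizDefect_mul_commutator {F : Set A} (hadd : ∀ X ∈ F, ∀ Y ∈ F, X + Y ∈ F)
    (hmul : ∀ X ∈ F, ∀ Y ∈ F, X * Y ∈ F)
    (hJ : ∀ X ∈ F, ∀ Y ∈ F, leibnizDefect φ X Y + leibnizDefect φ Y X = 0)
    {X Y Z : A} (hX : X ∈ F) (hY : Y ∈ F) (hZ : Z ∈ F) :
    leibnizDefect φ X Y * Z * (X * Y - Y * X) + (X * Y - Y * X) * Z * leibnizDefect φ X Y = 0 := by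
  have hJ' : ∀ X ∈ F, ∀ Y ∈ F,
      φ (X * Y) + φ (Y * X) = φ X * Y + X * φ Y + φ Y * X + Y * φ X := by
    intro X hX Y hY
    have := hJ X hX Y hY
    simp only [leibnizDefect] at this
    rw [← sub_eq_zero, ← this]
    abel
  have triple : ∀ X ∈ F, ∀ Y ∈ F,
      φ (X * Y * X) = φ X * Y * X + X * φ Y * X + X * Y * φ X := by
    intro X hX Y hY
    have h1 := hJ' X hX (X * Y + Y * X) (hadd _ (hmul _ hX _ hY) _ (hmul _ hY _ hX))
    have h2 := hJ' (X * X) (hmul _ hX _ hX) Y hY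
    have h3 := hJ' X hX Y hY
    have h4 := hJ' X hX X hX
    have h3' : φ (X * Y) = φ X * Y + X * φ Y + φ Y * X + Y * φ X - φ (Y * X) := by
      rw [← h3]; abel
    have h4' : φ (X * X) = φ X * X + X * φ X := by
      have : (2 : ℂ) • φ (X * X) = (2 : ℂ) • (φ X * X + X * φ X) := by
        rw [two_smul, two_smul, h4]; abel
      exact smul_right_injective A (two_ne_zero (α := ℂ)) this
    have h5 : (2 : ℂ) • φ (X * Y * X) =
        (2 : ℂ) • (φ X * Y * X + X * φ Y * X + X * Y * φ X) := by
      have e1 : (2 : ℂ) • φ (X * Y * X) = (φ (X * (X * Y + Y * X)) + φ ((X * Y + Y * X) * X)) -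
          (φ (X * X * Y) + φ (Y * (X * X))) := by
        simp only [mul_add, add_mul, map_add, mul_assoc, two_smul]
        abel
      rw [e1, h1, h2]
      simp only [map_add, h3', h4', two_smul]
      noncomm_ring
    exact smul_right_injective A (two_ne_zero (α := ℂ)) h5
  have triple' : ∀ U ∈ F, ∀ V ∈ F, ∀ Z ∈ F, φ (U * Z * V) + φ (V * Z * U) =
      φ U * Z * V + U * φ Z * V + U * Z * φ V + (φ V * Z * U + V * φ Z * U + V * Z * φ U) := by
    intro U hU V hV Z hZ
    have h1 := triple (U + V) (hadd _ hU _ hV) Z hZ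
    have e : φ (U * Z * V) + φ (V * Z * U) =
        φ ((U + V) * Z * (U + V)) - φ (U * Z * U) - φ (V * Z * V) := by
      simp only [mul_add, add_mul, map_add]
      abel
    rw [e, h1, triple U hU Z hZ, triple V hV Z hZ, map_add]
    noncomm_ring
  have hXY := hmul _ hX _ hY
  have hYX := hmul _ hY _ hX
  -- φ(XYZYX + YXZXY) is computed twice: by the polarized triple rule at XY and YX, and by nesting
  -- the triple rule. The difference is the claim.
  have h1 := triple' _ hXY _ hYX Z hZ
  have h2 := triple X hX (Y * Z * Y) (hmul _ (hmul _ hY _ hZ) _ hY)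
  have h3 := triple Y hY (X * Z * X) (hmul _ (hmul _ hX _ hZ) _ hX)
  rw [triple Y hY Z hZ] at h2
  rw [triple X hX Z hZ] at h3
  have e2 : X * Y * Z * (Y * X) = X * (Y * Z * Y) * X := by simp only [mul_assoc]
  have e3 : Y * X * Z * (X * Y) = Y * (X * Z * X) * Y := by simp only [mul_assoc]
  rw [e2, e3, h2, h3] at h1
  have h4 : φ (Y * X) = φ X * Y + X * φ Y + φ Y * X + Y * φ X - φ (X * Y) := by
    rw [← hJ' X hX Y hY]; abel
  rw [h4] at h1
  rw [← sub_eq_zero] at h1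
  rw [← h1]
  simp only [leibnizDefect]
  noncomm_ring

/-! ### Identities forced by derivability at G -/

variable {φ}
variable {G : A}

/-- The Leibniz rule at the factorizations of `G` that arise by moving `X`. -/
theorem IsDerivableAt.balanced (h : IsDerivableAt φ G) {X S T : A}
    (hX : X ∈ Submodule.span ℂ {P : A | IsIdempotentElem P}) (hST : S * T = G) :
    φ (S * X) * T + S * X * φ T = φ S * X * T + S * φ (X * T) := by
  have := bilin_balanced (m := φ G) (LinearMap.mk₂ ℂ (fun S T => φ S * T + S * φ T)
    (fun _ _ _ => by simp only [map_add, add_mul]; abel)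
    (fun _ _ _ => by simp only [map_smul, smul_mul_assoc, smul_add])
    (fun _ _ _ => by simp only [map_add, mul_add]; abel)
    (fun _ _ _ => by simp only [map_smul, mul_smul_comm, smul_add]))
    (fun S T hST => by
      rw [LinearMap.mk₂_apply, ← h S T hST, hST]) hX hST
  simpa [mul_assoc] using this

theorem IsDerivableAt.map_one_mul (h : IsDerivableAt φ G) : φ 1 * G = 0 := by
  simpa using h 1 G (one_mul G)

theorem IsDerivableAt.mul_map_one (h : IsDerivableAt φ G) : G * φ 1 = 0 := by
  simpa using h G 1 (mul_one G)

/-- Balancing twice. -/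
theorem IsDerivableAt.balanced_balanced (h : IsDerivableAt φ G) {X Q S T : A}
    (hX : X ∈ Submodule.span ℂ {P : A | IsIdempotentElem P})
    (hQ : Q ∈ Submodule.span ℂ {P : A | IsIdempotentElem P}) (hST : S * T = G) :
    φ (S * Q * X) * T + S * Q * X * φ T - φ (S * Q) * X * T - S * Q * φ (X * T) =
      φ (S * X) * (Q * T) + S * X * φ (Q * T) - φ S * X * (Q * T) - S * φ (X * (Q * T)) := by
  have := bilin_balanced (m := (0 : A)) (LinearMap.mk₂ ℂ
      (fun S T => φ (S * X) * T + S * X * φ T - φ S * X * T - S * φ (X * T))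
    (fun _ _ _ => by simp only [map_add, add_mul]; abel)
    (fun _ _ _ => by simp only [map_smul, smul_mul_assoc, smul_add, smul_sub])
    (fun _ _ _ => by simp only [map_add, mul_add]; abel)
    (fun _ _ _ => by simp only [map_smul, mul_smul_comm, smul_add, smul_sub]))
    (fun S T hST => by
      rw [LinearMap.mk₂_apply, h.balanced hX hST]; abel) hQ hST
  simpa only [LinearMap.mk₂_apply] using this

/-- `φ` corrected so as to vanish at `1`. -/
def unitalPart (φ : A →ₗ[ℂ] A) : A →ₗ[ℂ] A := φ - LinearMap.mulLeft ℂ (φ 1)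

theorem unitalPart_apply (X : A) : unitalPart φ X = φ X - φ 1 * X := rfl

theorem leibnizDefect_unitalPart (X Y : A) : leibnizDefect (unitalPart φ) X Y =
    φ (X * Y) - φ X * Y - X * φ Y + X * φ 1 * Y := by
  simp only [leibnizDefect, unitalPart_apply]
  noncomm_ring

theorem IsDerivableAt.map_mul (h : IsDerivableAt φ G) {X : A}
    (hX : X ∈ Submodule.span ℂ {P : A | IsIdempotentElem P}) :
    φ (X * G) = φ X * G + X * φ G - φ 1 * X * G := by
  have := h.balanced hX (one_mul G)
  simp only [one_mul] at this
  rw [this]; abel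

theorem IsDerivableAt.map_mul' (h : IsDerivableAt φ G) {X : A}
    (hX : X ∈ Submodule.span ℂ {P : A | IsIdempotentElem P}) :
    φ (G * X) = φ G * X + G * φ X - G * X * φ 1 := by
  have := h.balanced hX (mul_one G)
  simp only [mul_one] at this
  rw [← this]; abel

theorem IsDerivableAt.leibnizDefect_right (h : IsDerivableAt φ G) {X : A}
    (hX : X ∈ Submodule.span ℂ {P : A | IsIdempotentElem P}) :
    leibnizDefect (unitalPart φ) X G = -(φ 1 * X * G) := by
  rw [leibnizDefect_unitalPart, h.map_mul hX, mul_assoc X, h.map_one_mul]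
  noncomm_ring

theorem IsDerivableAt.leibnizDefect_left (h : IsDerivableAt φ G) {X : A}
    (hX : X ∈ Submodule.span ℂ {P : A | IsIdempotentElem P}) :
    leibnizDefect (unitalPart φ) G X = -(G * X * φ 1) := by
  rw [leibnizDefect_unitalPart, h.map_mul' hX, h.mul_map_one]
  noncomm_ring

/-- The Jordan form of the Leibniz rule holds up to a right annihilation by `G`. -/
theorem IsDerivableAt.jordan_mul (h : IsDerivableAt φ G) {X Y : A}
    (hX : X ∈ Submodule.span ℂ {P : A | IsIdempotentElem P})
    (hY : Y ∈ Submodule.span ℂ {P : A | IsIdempotentElem P})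
    (hXY : X * Y ∈ Submodule.span ℂ {P : A | IsIdempotentElem P}) :
    (leibnizDefect (unitalPart φ) X Y + leibnizDefect (unitalPart φ) Y X) * G = 0 := by
  have := h.balanced_balanced hX hY (one_mul G)
  rw [← mul_assoc X Y G, h.map_mul hX, h.map_mul hY, h.map_mul hXY, ← sub_eq_zero] at this
  rw [← this]
  simp only [leibnizDefect_unitalPart]
  noncomm_ring

/-- The Jordan form of the Leibniz rule holds up to a left annihilation by `G`. -/
theorem IsDerivableAt.mul_jordan (h : IsDerivableAt φ G) {X Y : A}
    (hX : X ∈ Submodule.span ℂ {P : A | IsIdempotentElem P})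
    (hY : Y ∈ Submodule.span ℂ {P : A | IsIdempotentElem P})
    (hXY : Y * X ∈ Submodule.span ℂ {P : A | IsIdempotentElem P}) :
    G * (leibnizDefect (unitalPart φ) X Y + leibnizDefect (unitalPart φ) Y X) = 0 := by
  have := h.balanced_balanced hX hY (mul_one G)
  simp only [mul_one] at this
  rw [mul_assoc G Y X, h.map_mul' hX, h.map_mul' hY, h.map_mul' hXY, ← sub_eq_zero] at this
  rw [← neg_eq_zero, ← neg_eq_zero, ← this]
  simp only [leibnizDefect_unitalPart]
  noncomm_ring

theorem IsDerivableAt.leibnizDefect_mul_right (h : IsDerivableAt φ G) {X Y : A}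
    (hY : Y ∈ Submodule.span ℂ {P : A | IsIdempotentElem P})
    (hXY : X * Y ∈ Submodule.span ℂ {P : A | IsIdempotentElem P}) :
    leibnizDefect (unitalPart φ) X Y * G =
      leibnizDefect (unitalPart φ) X (Y * G) - (X * φ 1 - φ 1 * X) * Y * G := by
  have := leibnizDefect_cocycle (unitalPart φ) X Y G
  rw [h.leibnizDefect_right hY, h.leibnizDefect_right hXY] at this
  rw [eq_sub_iff_add_eq, ← sub_eq_zero, ← neg_eq_zero, ← sub_eq_zero.2 this]
  noncomm_ring

theorem IsDerivableAt.mul_leibnizDefect (h : IsDerivableAt φ G) {X Y : A}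
    (hX : X ∈ Submodule.span ℂ {P : A | IsIdempotentElem P})
    (hXY : X * Y ∈ Submodule.span ℂ {P : A | IsIdempotentElem P}) :
    G * leibnizDefect (unitalPart φ) X Y =
      leibnizDefect (unitalPart φ) (G * X) Y + G * X * (Y * φ 1 - φ 1 * Y) := by
  have := leibnizDefect_cocycle (unitalPart φ) G X Y
  rw [h.leibnizDefect_left hX, h.leibnizDefect_left hXY] at this
  rw [← sub_eq_zero, ← sub_eq_zero.2 this]
  noncomm_ring

end Algebra

/-! ### Finite-rank operators -/

section Hilbert

open InnerProductSpace
open scoped InnerProductSpace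

variable {H : Type*} [NormedAddCommGroup H] [InnerProductSpace ℂ H]

variable (H) in
/-- The ideal of operators of finite rank, as the span of the operators of rank one. -/
def finiteRank : Submodule ℂ (H →L[ℂ] H) :=
  Submodule.span ℂ {X | ∃ x y : H, X = rankOne ℂ x y}

theorem rankOne_mem_finiteRank (x y : H) : rankOne ℂ x y ∈ finiteRank H :=
  Submodule.subset_span ⟨x, y, rfl⟩

theorem finiteRank_induction {p : (H →L[ℂ] H) → Prop} (hr : ∀ x y, p (rankOne ℂ x y))
    (hadd : ∀ X Y, p X → p Y → p (X + Y)) (hsmul : ∀ (a : ℂ) X, p X → p (a • X))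
    {X : H →L[ℂ] H} (hX : X ∈ finiteRank H) : p X := by
  induction hX using Submodule.span_induction with
  | mem X hX => obtain ⟨x, y, rfl⟩ := hX; exact hr x y
  | zero => simpa using hr 0 0
  | add X Y _ _ hX hY => exact hadd X Y hX hY
  | smul a X _ hX => exact hsmul a X hX

theorem mul_rankOne (T : H →L[ℂ] H) (x y : H) : T * rankOne ℂ x y = rankOne ℂ (T x) y := by
  ext z
  simp

theorem mul_mem_finiteRank_left (T : H →L[ℂ] H) {X : H →L[ℂ] H} (hX : X ∈ finiteRank H) :
    T * X ∈ finiteRank H := by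
  refine finiteRank_induction (p := fun X => T * X ∈ finiteRank H) (fun x y => ?_)
    (fun X Y hX hY => ?_) (fun a X hX => ?_) hX
  · rw [mul_rankOne]
    exact rankOne_mem_finiteRank _ _
  · rw [mul_add]
    exact add_mem hX hY
  · rw [mul_smul_comm]
    exact Submodule.smul_mem _ _ hX

/-- x⊗y is a multiple of an idempotent unless ⟪y,x⟫ = 0; then, for y ≠ 0, it is (x+y)⊗y − y⊗y. -/
theorem finiteRank_le_span_isIdempotentElem :
    finiteRank H ≤ Submodule.span ℂ {P : H →L[ℂ] H | IsIdempotentElem P} := by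
  have key : ∀ x y : H, ⟪y, x⟫_ℂ ≠ 0 →
      rankOne ℂ x y ∈ Submodule.span ℂ {P : H →L[ℂ] H | IsIdempotentElem P} := by
    intro x y hxy
    have h1 : IsIdempotentElem ((⟪y, x⟫_ℂ)⁻¹ • rankOne ℂ x y) := by
      ext z
      simp only [mul_apply_eq_comp, smul_apply, rankOne_apply,
        map_smul, smul_smul]
      congr 1
      field_simp
    have h2 : rankOne ℂ x y = ⟪y, x⟫_ℂ • ((⟪y, x⟫_ℂ)⁻¹ • rankOne ℂ x y) := by
      rw [smul_smul, mul_inv_cancel₀ hxy, one_smul]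
    rw [h2]
    exact Submodule.smul_mem _ _ (Submodule.subset_span h1)
  refine Submodule.span_le.2 ?_
  rintro _ ⟨x, y, rfl⟩
  by_cases hxy : ⟪y, x⟫_ℂ = 0
  · by_cases hy : y = 0
    · simp [hy]
    · have hyy : ⟪y, y⟫_ℂ ≠ 0 := inner_self_ne_zero.2 hy
      have h1 := key (x + y) y (by rwa [inner_add_right, hxy, zero_add])
      have h2 := key y y hyy
      have h3 : rankOne ℂ x y = rankOne ℂ (x + y) y - rankOne ℂ y y := by
        ext z
        simp
      rw [h3]
      exact sub_mem h1 h2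
  · exact key x y hxy

/-- At z the hypothesis reads ⟪y,Tz⟫Sx = ⟪y,T'z⟫S'x. Taking y = Tz ≠ 0 gives μ; an x with S'x ≠ 0
then compares T' with T. -/
theorem exists_smul_of_mul_rankOne_mul_eq {S S' T T' : H →L[ℂ] H} (hT : T ≠ 0)
    (h : ∀ x y, S * rankOne ℂ x y * T = S' * rankOne ℂ x y * T') :
    ∃ μ : ℂ, S = μ • S' ∧ (S' ≠ 0 → T' = μ • T) := by
  have h' : ∀ x y z, ⟪y, T z⟫_ℂ • S x = ⟪y, T' z⟫_ℂ • S' x := by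
    intro x y z
    simpa using congr($(h x y) z)
  obtain ⟨z, hz⟩ : ∃ z, T z ≠ 0 := by
    by_contra! hc
    exact hT (ContinuousLinearMap.ext hc)
  have hzz : ⟪T z, T z⟫_ℂ ≠ 0 := inner_self_ne_zero.2 hz
  refine ⟨(⟪T z, T z⟫_ℂ)⁻¹ * ⟪T z, T' z⟫_ℂ, ?_, fun hS' => ?_⟩
  · ext x
    have := h' x (T z) z
    rw [smul_apply, mul_smul, ← this, smul_smul, inv_mul_cancel₀ hzz, one_smul]
  · obtain ⟨x, hx⟩ : ∃ x, S' x ≠ 0 := by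
      by_contra! hc
      exact hS' (ContinuousLinearMap.ext hc)
    ext w
    refine ext_inner_left ℂ fun y => ?_
    have h1 := h' x (T z) z
    have h2 := h' x y w
    have h3 : (⟪T z, T z⟫_ℂ * ⟪y, T' w⟫_ℂ - ⟪y, T w⟫_ℂ * ⟪T z, T' z⟫_ℂ) • S' x = 0 := by
      rw [sub_smul, mul_smul, ← h2, mul_smul, ← h1, smul_smul, smul_smul, mul_comm, sub_self]
    have h4 := sub_eq_zero.1 ((smul_eq_zero.1 h3).resolve_right hx)
    rw [smul_apply, inner_smul_right]
    field_simp
    linear_combination h4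

theorem eq_zero_of_mul_rankOne_mul_eq_zero {S T : H →L[ℂ] H} (hT : T ≠ 0)
    (h : ∀ x y, S * rankOne ℂ x y * T = 0) : S = 0 := by
  obtain ⟨μ, hμ, -⟩ := exists_smul_of_mul_rankOne_mul_eq (S' := 0) (T' := 0) hT
    (fun x y => by rw [h]; simp)
  rw [hμ, smul_zero]

theorem eq_zero_of_eq_neg {V : Type*} [AddCommGroup V] [Module ℂ V] {x : V} (h : x = -x) :
    x = 0 := by
  have h1 : (2 : ℂ) • x = 0 := by
    rw [two_smul]
    exact add_eq_zero_iff_eq_neg.2 h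
  exact (smul_eq_zero.1 h1).resolve_left two_ne_zero

theorem eq_zero_or_eq_zero_of_mul_rankOne_mul_add {S T : H →L[ℂ] H}
    (h : ∀ x y, S * rankOne ℂ x y * T + T * rankOne ℂ x y * S = 0) : S = 0 ∨ T = 0 := by
  by_cases hT : T = 0
  · exact Or.inr hT
  · left
    obtain ⟨μ, h1, h2⟩ := exists_smul_of_mul_rankOne_mul_eq (S' := -T) (T' := S) hT
      (fun x y => by 
        have h1 := h x y
        have h2 := eq_neg_of_add_eq_zero_left h1
        rw [h2, neg_mul, neg_mul])
    have h3 := h2 (neg_ne_zero.2 hT)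
    rw [smul_neg, ← h3] at h1
    exact eq_zero_of_eq_neg h1

/-- `hrank` says that G has rank at least two. If Gr ≠ 0 is orthogonal to t, the right side vanishes
at r, while Z = z⊗Gr gives a nonzero multiple of Mz. -/
theorem eq_zero_of_mul_mul_eq_mul_rankOne_mul {G : H →L[ℂ] H}
    (hrank : ∀ t, ∃ r, G r ≠ 0 ∧ ⟪t, G r⟫_ℂ = 0)
    {M : H →L[ℂ] H} {x t : H}
    (h : ∀ Z ∈ finiteRank H, ∃ N, M * Z * G = N * rankOne ℂ x t * G) : M = 0 := by
  obtain ⟨r, hr, htr⟩ := hrank t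
  ext z
  obtain ⟨N, hN⟩ := h _ (rankOne_mem_finiteRank z (G r))
  simpa [htr, hr] using congr($hN r)

theorem forall_eq_zero_of_apply_ne_zero {V : Type*} [AddCommGroup V]
    {G : H →L[ℂ] H} {L : H → V}
    (hL : ∀ x y, L (x + y) = L x + L y) (hG : G ≠ 0) (h : ∀ x, G x ≠ 0 → L x = 0) (x : H) :
    L x = 0 := by
  obtain ⟨r, hr⟩ : ∃ r, G r ≠ 0 := by
    by_contra! hc
    exact hG (ContinuousLinearMap.ext hc)
  by_cases hx : G x = 0
  · have := h (x + r) (by rwa [map_add, hx, zero_add])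
    rwa [hL, h r hr, add_zero] at this
  · exact h x hx

theorem eq_zero_of_inner_eq_zero {a t u : H} (hta : ⟪t, a⟫_ℂ ≠ 0)
    (h : ∀ s, ⟪s, a⟫_ℂ ≠ 0 → ⟪s, u⟫_ℂ = 0) : u = 0 := by
  refine ext_inner_left ℂ fun s => ?_
  rw [inner_zero_right]
  by_cases hs : ⟪s, a⟫_ℂ = 0
  · have := h (s + t) (by rwa [inner_add_left, hs, zero_add])
    rwa [inner_add_left, h t hta, add_zero] at this
  · exact h s hs

/-! ### Vanishing of the defect on finite-rank operators -/

/-- The operators R = w⊗v form a left ideal with RG = 0, so `hq` removes most cocycle terms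
containing R. The defect vanishes first at such R, then in general because (w⊗v)(v⊗u) is a nonzero
multiple of w⊗u. -/
theorem leibnizDefect_eq_zero_of_not_denseRange {ψ : (H →L[ℂ] H) →ₗ[ℂ] (H →L[ℂ] H)}
    {G : H →L[ℂ] H} {v : H} (hv : v ≠ 0) (hG : ∀ z, ⟪v, G z⟫_ℂ = 0)
    (hrank : ∀ t, ∃ r, G r ≠ 0 ∧ ⟪t, G r⟫_ℂ = 0)
    (hJ : ∀ X ∈ finiteRank H, ∀ Y ∈ finiteRank H,
      (leibnizDefect ψ X Y + leibnizDefect ψ Y X) * G = 0)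
    (hJ' : ∀ X ∈ finiteRank H, ∀ Y ∈ finiteRank H,
      G * (leibnizDefect ψ X Y + leibnizDefect ψ Y X) = 0)
    (hq : ∀ X ∈ finiteRank H, ∀ Y ∈ finiteRank H, Y * G = 0 → leibnizDefect ψ X Y * G = 0)
    {X Y : H →L[ℂ] H} (hX : X ∈ finiteRank H) (hY : Y ∈ finiteRank H) :
    leibnizDefect ψ X Y = 0 := by
  have hanti : ∀ X ∈ finiteRank H, ∀ Y ∈ finiteRank H,
      leibnizDefect ψ X Y * G = -(leibnizDefect ψ Y X * G) := fun X hX Y hY =>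
    eq_neg_of_add_eq_zero_left (by rw [← add_mul]; exact hJ X hX Y hY)
  have hR : ∀ w, rankOne ℂ w v ∈ finiteRank H := fun w => rankOne_mem_finiteRank w v
  have hRG : ∀ w, rankOne ℂ w v * G = 0 := fun w => by ext z; simp [hG]
  have ha : ∀ w, ∀ X ∈ finiteRank H, ∀ Z ∈ finiteRank H,
      leibnizDefect ψ X (rankOne ℂ w v) * Z * G =
        leibnizDefect ψ X (rankOne ℂ w v * Z) * G := by
    intro w X hX Z hZ
    have h1 := congr($(leibnizDefect_cocycle ψ X (rankOne ℂ w v) Z) * G)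
    have h2 : leibnizDefect ψ (rankOne ℂ w v) Z * G = 0 := by
      rw [hanti _ (hR w) _ hZ, hq _ hZ _ (hR w) (hRG w), neg_zero]
    have h3 : leibnizDefect ψ (X * rankOne ℂ w v) Z * G = 0 := by
      rw [mul_rankOne, hanti _ (hR _) _ hZ, hq _ hZ _ (hR _) (hRG _), neg_zero]
    rw [add_mul, add_mul, mul_assoc X, h2, h3, mul_zero, zero_add, zero_add] at h1
    exact h1.symm
  have hb : ∀ w, ∀ X ∈ finiteRank H, ∀ Z ∈ finiteRank H,
      leibnizDefect ψ (rankOne ℂ w v) X * Z * G =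
        rankOne ℂ w v * (leibnizDefect ψ X Z * G) +
          leibnizDefect ψ Z (rankOne ℂ w v) * X * G := by
    intro w X hX Z hZ
    have h1 := congr($(leibnizDefect_cocycle ψ (rankOne ℂ w v) X Z) * G)
    have hXZ := mul_mem_finiteRank_left X hZ
    have h2 : leibnizDefect ψ (rankOne ℂ w v) (X * Z) * G = 0 := by
      rw [hanti _ (hR w) _ hXZ, hq _ hXZ _ (hR w) (hRG w), neg_zero]
    rw [add_mul, add_mul, h2, add_zero,
      hanti _ (mul_mem_finiteRank_left _ hX) _ hZ, ← ha w Z hZ X hX, mul_assoc] at h1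
    rw [h1]
    abel
  obtain ⟨r₀, hr₀, -⟩ := hrank 0
  have hc : ∀ w, ∀ X ∈ finiteRank H, ∀ Z ∈ finiteRank H,
      rankOne ℂ w v * (leibnizDefect ψ X Z * G) = 0 := by
    intro w X hX Z hZ
    have hs : ∀ X ∈ finiteRank H, ∀ Z ∈ finiteRank H,
        G * (leibnizDefect ψ X (rankOne ℂ r₀ v) * Z * G +
          (rankOne ℂ r₀ v * (leibnizDefect ψ X Z * G) +
          leibnizDefect ψ Z (rankOne ℂ r₀ v) * X * G)) = 0 := by
      intro X hX Z hZ
      rw [← hb r₀ X hX Z hZ, ← add_mul, ← add_mul, ← mul_assoc, ← mul_assoc,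
        hJ' X hX _ (hR r₀), zero_mul, zero_mul]
    -- Swapping X and Z exchanges the outer terms and negates the middle one, which therefore
    -- vanishes.
    have h1 := hs X hX Z hZ
    have h2 := hs Z hZ X hX
    rw [hanti Z hZ X hX] at h2
    have h3 : (2 : ℂ) • (G * (rankOne ℂ r₀ v * (leibnizDefect ψ X Z * G))) = 0 := by
      rw [← sub_eq_zero.2 (h1.trans h2.symm), two_smul]
      noncomm_ring
    have h4 := (smul_eq_zero.1 h3).resolve_left two_ne_zero
    ext z
    have h5 := congr($h4 z)
    simp only [mul_apply_eq_comp, rankOne_apply, map_smul,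
      zero_apply, smul_eq_zero, hr₀, or_false] at h5 ⊢
    exact Or.inl h5
  have hd : ∀ w, ∀ X ∈ finiteRank H,
      leibnizDefect ψ X (rankOne ℂ w v) + leibnizDefect ψ (rankOne ℂ w v) X = 0 := by
    intro w X hX
    refine finiteRank_induction (p := fun X =>
      leibnizDefect ψ X (rankOne ℂ w v) + leibnizDefect ψ (rankOne ℂ w v) X = 0) (fun x t => ?_)
      (fun X X' hX hX' => ?_) (fun a X hX => ?_) hX
    · have hXm := rankOne_mem_finiteRank x t
      -- By `hb` and `hc` the left side is symmetric in X and Z, so X = x⊗t can be placed next to G.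
      refine eq_zero_of_mul_mul_eq_mul_rankOne_mul (x := x) (t := t) hrank fun Z hZ =>
        ⟨leibnizDefect ψ Z (rankOne ℂ w v) + leibnizDefect ψ (rankOne ℂ w v) Z, ?_⟩
      rw [add_mul, add_mul, add_mul, add_mul, hb w _ hXm Z hZ, hb w Z hZ _ hXm, hc w _ hXm Z hZ,
        hc w Z hZ _ hXm]
      abel
    · rw [leibnizDefect_add_left, leibnizDefect_add_right, add_add_add_comm, hX, hX', add_zero]
    · rw [leibnizDefect_smul_left, leibnizDefect_smul_right, ← smul_add, hX, smul_zero]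
  have he : ∀ w, ∀ X ∈ finiteRank H, leibnizDefect ψ X (rankOne ℂ w v) = 0 := by
    intro w X hX
    refine finiteRank_induction (p := fun X =>
      leibnizDefect ψ X (rankOne ℂ w v) = 0) (fun x t => ?_)
      (fun X X' hX hX' => ?_) (fun a X hX => ?_) hX
    · have hXm := rankOne_mem_finiteRank x t
      refine eq_zero_of_mul_mul_eq_mul_rankOne_mul (x := x) (t := t) hrank fun Z hZ =>
        ⟨-leibnizDefect ψ Z (rankOne ℂ w v), ?_⟩
      have h1 := hb w _ hXm Z hZ
      rw [hc w _ hXm Z hZ, zero_add, eq_neg_of_add_eq_zero_right (hd w _ hXm)] at h1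
      rw [neg_mul, neg_mul, ← h1, neg_mul, neg_mul, neg_neg]
    · rw [leibnizDefect_add_left, hX, hX', add_zero]
    · rw [leibnizDefect_smul_left, hX, smul_zero]
  have he' : ∀ w, ∀ X ∈ finiteRank H, leibnizDefect ψ (rankOne ℂ w v) X = 0 := by
    intro w X hX
    have := hd w X hX
    rwa [he w X hX, zero_add] at this
  refine finiteRank_induction (p := fun Y => leibnizDefect ψ X Y = 0) (fun w u => ?_)
    (fun Y Y' hY hY' => ?_) (fun a Y hY => ?_) hY
  · have hvu := rankOne_mem_finiteRank v u
    have h1 := leibnizDefect_cocycle ψ X (rankOne ℂ w v) (rankOne ℂ v u)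
    rw [he' w _ hvu, he w X hX, mul_rankOne X w v, he' _ _ hvu, mul_rankOne, rankOne_apply] at h1
    simpa [leibnizDefect_smul_right, hv] using h1
  · rw [leibnizDefect_add_right, hY, hY', add_zero]
  · rw [leibnizDefect_smul_right, hY, smul_zero]

variable [CompleteSpace H] {ψ : (H →L[ℂ] H) →ₗ[ℂ] (H →L[ℂ] H)} {G : H →L[ℂ] H}

theorem mul_mem_finiteRank_right (T : H →L[ℂ] H) {X : H →L[ℂ] H} (hX : X ∈ finiteRank H) :
    X * T ∈ finiteRank H := by
  refine finiteRank_induction (p := fun X => X * T ∈ finiteRank H) (fun x y => ?_)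
    (fun X Y hX hY => ?_) (fun a X hX => ?_) hX
  · have : rankOne ℂ x y * T = rankOne ℂ x (ContinuousLinearMap.adjoint T y) := by
      ext z
      simp [ContinuousLinearMap.adjoint_inner_left]
    rw [this]
    exact rankOne_mem_finiteRank _ _
  · rw [add_mul]
    exact add_mem hX hY
  · rw [smul_mul_assoc]
    exact Submodule.smul_mem _ _ hX

/-- Dense range cancels G, so the Jordan rule is exact. Brešar's identity and primeness then kill
the defect at noncommuting pairs; a Y commuting with a rank-one X is written as (W + Y) − W with W
not commuting with X. -/
theorem leibnizDefect_eq_zero_of_denseRange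
    (hG : ∀ v, (∀ z, ⟪v, G z⟫_ℂ = 0) → v = 0)
    (hrank : ∀ t, ∃ r, G r ≠ 0 ∧ ⟪t, G r⟫_ℂ = 0)
    (hJ : ∀ X ∈ finiteRank H, ∀ Y ∈ finiteRank H,
      (leibnizDefect ψ X Y + leibnizDefect ψ Y X) * G = 0)
    {X Y : H →L[ℂ] H} (hX : X ∈ finiteRank H) (hY : Y ∈ finiteRank H) :
    leibnizDefect ψ X Y = 0 := by
  have hJ0 : ∀ X ∈ finiteRank H, ∀ Y ∈ finiteRank H,
      leibnizDefect ψ X Y + leibnizDefect ψ Y X = 0 := by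
    intro X hX Y hY
    set M := leibnizDefect ψ X Y + leibnizDefect ψ Y X with hM
    have hMG := hJ X hX Y hY
    ext z
    refine ext_inner_left ℂ fun y => ?_
    have h0 : ContinuousLinearMap.adjoint M y = 0 := by
      refine hG _ fun z => ?_
      rw [ContinuousLinearMap.adjoint_inner_left]
      have := congr($hMG z)
      rw [mul_apply_eq_comp] at this
      rw [this]
      simp
    rw [← ContinuousLinearMap.adjoint_inner_left, h0]
    simp
  have hcomm : ∀ X ∈ finiteRank H, ∀ Y ∈ finiteRank H, X * Y - Y * X ≠ 0 →
      leibnizDefect ψ X Y = 0 := by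
    intro X hX Y hY hne
    refine (eq_zero_or_eq_zero_of_mul_rankOne_mul_add fun x y => ?_).resolve_right hne
    exact leibnizDefect_mul_commutator ψ (F := (finiteRank H : Set (H →L[ℂ] H)))
      (fun _ hX _ hY => add_mem hX hY) (fun _ _ _ hY => mul_mem_finiteRank_left _ hY)
      hJ0 hX hY (rankOne_mem_finiteRank x y)
  refine finiteRank_induction (p := fun X => leibnizDefect ψ X Y = 0) (fun x y => ?_)
    (fun X X' hX hX' => ?_) (fun a X hX => ?_) hX
  · by_cases h0 : rankOne ℂ x y = 0
    · rw [h0, leibnizDefect_zero_left]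
    rw [rankOne_eq_zero, not_or] at h0
    obtain ⟨r, hr, hxr⟩ := hrank x
    have hW := rankOne_mem_finiteRank (G r) x
    -- Evaluated at y and paired with Gr, which is orthogonal to x, only the second product
    -- survives.
    have hne : rankOne ℂ x y * rankOne ℂ (G r) x - rankOne ℂ (G r) x * rankOne ℂ x y ≠ 0 := by
      intro hc
      have h1 := congr(⟪G r, $hc y⟫_ℂ)
      have hrx : ⟪G r, x⟫_ℂ = 0 := inner_eq_zero_symm.1 hxr
      simp [hrx, h0, hr] at h1
    have hXm := rankOne_mem_finiteRank x y
    by_cases hXY : rankOne ℂ x y * Y - Y * rankOne ℂ x y = 0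
    · have h1 := hcomm _ hXm _ hW hne
      have h2 := hcomm _ hXm _ (add_mem hW hY) (by
        rw [mul_add, add_mul, add_sub_add_comm, hXY, add_zero]
        exact hne)
      rwa [leibnizDefect_add_right, h1, zero_add] at h2
    · exact hcomm _ hXm _ hY hXY
  · rw [leibnizDefect_add_left, hX, hX', add_zero]
  · rw [leibnizDefect_smul_left, hX, smul_zero]

theorem IsDerivableAt.leibnizDefect_eq_zero_of_rank_one
    {φ : (H →L[ℂ] H) →ₗ[ℂ] (H →L[ℂ] H)} (h : IsDerivableAt φ G) {t r₀ : H}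
    (htr : ⟪t, G r₀⟫_ℂ = 1) (hG : ∀ r, G r = ⟪t, G r⟫_ℂ • G r₀)
    (hJ : ∀ X ∈ finiteRank H, ∀ Y ∈ finiteRank H,
      (leibnizDefect (unitalPart φ) X Y + leibnizDefect (unitalPart φ) Y X) * G = 0)
    (hJ' : ∀ X ∈ finiteRank H, ∀ Y ∈ finiteRank H,
      G * (leibnizDefect (unitalPart φ) X Y + leibnizDefect (unitalPart φ) Y X) = 0)
    (hq : ∀ X ∈ finiteRank H, ∀ Y ∈ finiteRank H, Y * G = 0 →
      leibnizDefect (unitalPart φ) X Y * G = 0)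
    {X Y : H →L[ℂ] H} (hX : X ∈ finiteRank H) (hY : Y ∈ finiteRank H) :
    leibnizDefect (unitalPart φ) X Y = 0 := by
  have hsp := finiteRank_le_span_isIdempotentElem (H := H)
  have hanti : ∀ X ∈ finiteRank H, ∀ Y ∈ finiteRank H, leibnizDefect (unitalPart φ) X Y * G =
      -(leibnizDefect (unitalPart φ) Y X * G) := fun X hX Y hY =>
    eq_neg_of_add_eq_zero_left (by rw [← add_mul]; exact hJ X hX Y hY)
  have hta : ⟪t, G r₀⟫_ℂ ≠ 0 := by rw [htr]; exact one_ne_zero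
  have hG0 : G ≠ 0 := by
    rintro rfl
    simp at hta
  have hcomp : ∀ X, G * X * G = ⟪t, G (X (G r₀))⟫_ℂ • G := by
    intro X
    ext r
    simp only [mul_apply_eq_comp, smul_apply]
    conv_lhs => rw [hG r, map_smul, map_smul, hG (X (G r₀)), smul_smul, mul_comm, mul_smul]
    rw [← hG r]
  have hGfG : ∀ X ∈ finiteRank H, ∀ Y ∈ finiteRank H,
      G * leibnizDefect (unitalPart φ) X Y * G = -(G * X * φ 1 * Y * G) := by
    intro X hX Y hY
    have hGX := mul_mem_finiteRank_left G hX
    -- Antisymmetry moves GX next to the right-hand G, and in rank one GXG is a multiple of G.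
    have h1 : leibnizDefect (unitalPart φ) (G * X) Y * G = 0 := by
      rw [hanti _ hGX _ hY, h.leibnizDefect_mul_right (hsp hGX)
        (hsp (mul_mem_finiteRank_left _ hGX)), mul_assoc _ (G * X) G, hcomp,
        leibnizDefect_smul_right, h.leibnizDefect_right (hsp hY), mul_smul_comm, ← smul_sub,
        sub_mul, mul_assoc Y, h.map_one_mul]
      simp
    rw [h.mul_leibnizDefect (hsp hX) (hsp (mul_mem_finiteRank_left _ hY)), add_mul, h1, zero_add,
      mul_assoc _ _ G, sub_mul, mul_assoc Y, h.map_one_mul]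
    noncomm_ring
  -- For X = x⊗s antisymmetry kills the defect at (X,X) times G, so GXφ(1)XG = 0. This gives
  -- ⟪s,φ(1)x⟫ = 0 for x outside ker G and s not orthogonal to Gr₀, which suffices.
  have hc : φ 1 = 0 := by
    ext x
    refine forall_eq_zero_of_apply_ne_zero (L := fun x => φ 1 x) (by simp) hG0 (fun x hx => ?_) x
    refine eq_zero_of_inner_eq_zero hta fun s hs => ?_
    have hXm := rankOne_mem_finiteRank x s
    have h1 := congr(G * $(hanti _ hXm _ hXm))
    rw [mul_neg, ← mul_assoc] at h1
    replace h1 := eq_zero_of_eq_neg h1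
    rw [hGfG _ hXm _ hXm, neg_eq_zero] at h1
    simpa [hs, hx] using congr($h1 r₀)
  have hGfG0 : ∀ X ∈ finiteRank H, ∀ Y ∈ finiteRank H,
      G * leibnizDefect (unitalPart φ) X Y * G = 0 := by
    intro X hX Y hY
    rw [hGfG X hX Y hY, hc]
    simp
  have hGX : ∀ X ∈ finiteRank H, ∀ Y ∈ finiteRank H, ∀ Z ∈ finiteRank H,
      G * X * (leibnizDefect (unitalPart φ) Y Z * G) =
        G * leibnizDefect (unitalPart φ) X Y * Z * G := by
    intro X hX Y hY Z hZ
    have h1 := congr(G * $(leibnizDefect_cocycle (unitalPart φ) X Y Z) * G)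
    rw [mul_add, mul_add, add_mul, add_mul, hGfG0 _ hX _ (mul_mem_finiteRank_left Y hZ),
      hGfG0 _ (mul_mem_finiteRank_left X hY) _ hZ, add_zero, zero_add] at h1
    simpa only [mul_assoc] using h1
  have hGXY : ∀ X ∈ finiteRank H, ∀ Y ∈ finiteRank H, ∀ Z ∈ finiteRank H,
      G * X * (leibnizDefect (unitalPart φ) Y Z * G) +
        G * Y * (leibnizDefect (unitalPart φ) X Z * G) = 0 := by
    intro X hX Y hY Z hZ
    rw [hGX X hX Y hY Z hZ, hGX Y hY X hX Z hZ, ← add_mul, ← add_mul, ← mul_add,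
      hJ' X hX Y hY, zero_mul, zero_mul]
  have hfG : ∀ X ∈ finiteRank H, ∀ Z ∈ finiteRank H,
      leibnizDefect (unitalPart φ) X Z * G = 0 := by
    intro X hX Z hZ
    refine finiteRank_induction (p := fun X => leibnizDefect (unitalPart φ) X Z * G = 0)
      (fun w s => ?_) (fun X X' hX hX' => ?_) (fun a X hX => ?_) hX
    · refine forall_eq_zero_of_apply_ne_zero
        (L := fun w => leibnizDefect (unitalPart φ) (rankOne ℂ w s) Z * G)
        (fun x y => ?_) hG0 (fun w hw => ?_) w
      · simp only [map_add, add_apply, leibnizDefect_add_left, add_mul]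
      have hzero : ∀ s', ⟪s', G r₀⟫_ℂ = 0 →
          leibnizDefect (unitalPart φ) (rankOne ℂ w s') Z * G = 0 := by
        intro s' hs'
        have hm := rankOne_mem_finiteRank w s'
        rw [hanti _ hm _ hZ, hq _ hZ _ hm, neg_zero]
        ext r
        simp only [mul_apply_eq_comp, rankOne_apply, zero_apply]
        rw [hG r, inner_smul_right, hs', mul_zero, zero_smul]
      by_cases hs : ⟪s, G r₀⟫_ℂ = 0
      · exact hzero s hs
      have hsum : ∀ s' r, ⟪s, (leibnizDefect (unitalPart φ) (rankOne ℂ w s') Z * G) r⟫_ℂ +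
          ⟪s', (leibnizDefect (unitalPart φ) (rankOne ℂ w s) Z * G) r⟫_ℂ = 0 := by
        intro s' r
        have h1 := congr($(hGXY _ (rankOne_mem_finiteRank w s) _ (rankOne_mem_finiteRank w s')
          Z hZ) r)
        rw [add_apply, mul_apply_eq_comp,
          mul_apply_eq_comp (G * _), mul_apply_eq_comp G,
          mul_apply_eq_comp G, rankOne_apply, rankOne_apply, map_smul, map_smul,
          ← add_smul] at h1
        exact (smul_eq_zero.1 h1).resolve_right hw
      ext r
      refine eq_zero_of_inner_eq_zero hta fun s' hs' => ?_
      have h1 := hsum s r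
      rw [← two_mul] at h1
      have h2 := (mul_eq_zero.1 h1).resolve_left two_ne_zero
      -- Subtracting b·s makes s' orthogonal to the range of G, where `hzero` applies; the multiple
      -- of s is covered by `h2`.
      obtain ⟨b, hb⟩ : ∃ b : ℂ, ⟪s' - b • s, G r₀⟫_ℂ = 0 := by
        refine ⟨starRingEnd ℂ (⟪s', G r₀⟫_ℂ / ⟪s, G r₀⟫_ℂ), ?_⟩
        rw [inner_sub_left, inner_smul_left, Complex.conj_conj, div_mul_cancel₀ _ hs, sub_self]
      have h3 := hsum (s' - b • s) r
      rwa [hzero _ hb, zero_apply, inner_zero_right, zero_add,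
        inner_sub_left, inner_smul_left, h2, mul_zero, sub_zero] at h3
    · rw [leibnizDefect_add_left, add_mul, hX, hX', add_zero]
    · rw [leibnizDefect_smul_left, smul_mul_assoc, hX, smul_zero]
  refine eq_zero_of_mul_rankOne_mul_eq_zero hG0 fun x y => ?_
  have hm := rankOne_mem_finiteRank x y
  have h1 := congr($(leibnizDefect_cocycle (unitalPart φ) X Y (rankOne ℂ x y)) * G)
  rw [add_mul, add_mul, mul_assoc X, hfG _ hY _ hm, hfG _ hX _ (mul_mem_finiteRank_left Y hm),
    hfG _ (mul_mem_finiteRank_left X hY) _ hm, mul_zero, zero_add, zero_add] at h1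
  exact h1.symm

theorem IsDerivableAt.leibnizDefect_eq_zero
    {φ : (H →L[ℂ] H) →ₗ[ℂ] (H →L[ℂ] H)} (h : IsDerivableAt φ G) (hG0 : G ≠ 0)
    {X Y : H →L[ℂ] H} (hX : X ∈ finiteRank H) (hY : Y ∈ finiteRank H) :
    leibnizDefect (unitalPart φ) X Y = 0 := by
  have hsp := finiteRank_le_span_isIdempotentElem (H := H)
  have hJ : ∀ X ∈ finiteRank H, ∀ Y ∈ finiteRank H,
      (leibnizDefect (unitalPart φ) X Y + leibnizDefect (unitalPart φ) Y X) * G = 0 :=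
    fun X hX Y hY => h.jordan_mul (hsp hX) (hsp hY) (hsp (mul_mem_finiteRank_left _ hY))
  have hJ' : ∀ X ∈ finiteRank H, ∀ Y ∈ finiteRank H,
      G * (leibnizDefect (unitalPart φ) X Y + leibnizDefect (unitalPart φ) Y X) = 0 :=
    fun X hX Y hY => h.mul_jordan (hsp hX) (hsp hY) (hsp (mul_mem_finiteRank_left _ hX))
  have hq : ∀ X ∈ finiteRank H, ∀ Y ∈ finiteRank H, Y * G = 0 →
      leibnizDefect (unitalPart φ) X Y * G = 0 := by
    intro X hX Y hY hYG
    rw [h.leibnizDefect_mul_right (hsp hY) (hsp (mul_mem_finiteRank_left _ hY)), hYG,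
      leibnizDefect_zero_right, mul_assoc, hYG, mul_zero, sub_zero]
  by_cases hrank : ∀ t, ∃ r, G r ≠ 0 ∧ ⟪t, G r⟫_ℂ = 0
  · by_cases hG : ∀ v, (∀ z, ⟪v, G z⟫_ℂ = 0) → v = 0
    · exact leibnizDefect_eq_zero_of_denseRange hG hrank hJ hX hY
    · push Not at hG
      obtain ⟨v, hv, hv0⟩ := hG
      exact leibnizDefect_eq_zero_of_not_denseRange hv0 hv hrank hJ hJ' hq hX hY
  -- Now ⟪t,·⟫ is injective on the range of G, so G has rank one; r is rescaled to give ⟪t,Gr₀⟫ = 1.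
  · push Not at hrank
    obtain ⟨t, ht⟩ := hrank
    obtain ⟨r, hr⟩ : ∃ r, G r ≠ 0 := by
      by_contra! hc
      exact hG0 (ContinuousLinearMap.ext hc)
    have htr := ht r hr
    refine h.leibnizDefect_eq_zero_of_rank_one (t := t) (r₀ := (⟪t, G r⟫_ℂ)⁻¹ • r) ?_ (fun z => ?_)
      hJ hJ' hq hX hY
    · rw [map_smul, inner_smul_right, inv_mul_cancel₀ htr]
    · by_contra hne
      refine ht (z - ⟪t, G z⟫_ℂ • (⟪t, G r⟫_ℂ)⁻¹ • r) ?_ ?_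
      · rw [map_sub, map_smul]
        exact sub_ne_zero.2 hne
      · rw [map_sub, map_smul, map_smul, inner_sub_right, inner_smul_right, inner_smul_right,
          inv_mul_cancel₀ htr, mul_one, sub_self]

/-! ### From finite rank to all of B(H) -/

/-- A derivation from the operators of finite rank into `B(H)` is inner. -/
theorem exists_eq_mul_sub_mul [Nontrivial H] {ψ : (H →L[ℂ] H) →ₗ[ℂ] (H →L[ℂ] H)}
    (h : ∀ X ∈ finiteRank H, ∀ Y ∈ finiteRank H, leibnizDefect ψ X Y = 0) :
    ∃ D : H →L[ℂ] H, ∀ X ∈ finiteRank H, ψ X = X * D - D * X := by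
  obtain ⟨e, he⟩ := exists_norm_eq H (zero_le_one (α := ℝ))
  have hee : ⟪e, e⟫_ℂ = 1 := by rw [inner_self_eq_norm_sq_to_K, he]; simp
  -- If ψ(X) = XD − DX, then ψ(x⊗e)e = ⟪e,De⟫x − Dx; D matters only up to a scalar, so ⟪e,De⟫ may be
  -- taken to be 0.
  let D₀ : H →ₗ[ℂ] H :=
    { toFun := fun x => -(ψ (rankOne ℂ x e) e)
      map_add' := fun x y => by
        simp only [map_add, add_apply, neg_add]
      map_smul' := fun a x => by
        simp only [map_smul, smul_apply, smul_neg, RingHom.id_apply] }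
  have hD₀ : ∀ X ∈ finiteRank H, ∀ x, ψ X x = X (D₀ x) - D₀ (X x) := by
    intro X hX x
    have h1 := congr($(h X hX _ (rankOne_mem_finiteRank x e)) e)
    rw [leibnizDefect, mul_rankOne] at h1
    simp only [sub_apply, mul_apply_eq_comp, rankOne_apply, hee,
      one_smul, zero_apply] at h1
    simp only [D₀, LinearMap.coe_mk, AddHom.coe_mk, map_neg]
    rw [← sub_eq_zero, ← neg_eq_zero, ← h1]
    abel
  -- Each value ψ(e⊗y) is a bounded operator, so D₀ is weakly continuous without any continuity of
  -- ψ; this closes its graph.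
  have hinner : ∀ y x, ⟪y, D₀ x⟫_ℂ = ⟪e, ψ (rankOne ℂ e y) x + ⟪y, x⟫_ℂ • D₀ e⟫_ℂ := by
    intro y x
    rw [hD₀ _ (rankOne_mem_finiteRank e y) x, rankOne_apply, rankOne_apply, map_smul,
      sub_add_cancel, inner_smul_right, hee, mul_one]
  have hcont : Continuous D₀ := by
    refine D₀.continuous_of_seq_closed_graph fun u x y hu hDu => ?_
    refine ext_inner_left ℂ fun z => ?_
    refine tendsto_nhds_unique (Filter.Tendsto.inner tendsto_const_nhds hDu) ?_
    have hc : Continuous fun x => ⟪e, ψ (rankOne ℂ e z) x + ⟪z, x⟫_ℂ • D₀ e⟫_ℂ := by fun_prop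
    have := (hc.tendsto x).comp hu
    rw [← hinner] at this
    refine this.congr fun n => ?_
    exact (hinner z (u n)).symm
  refine ⟨⟨D₀, hcont⟩, fun X hX => ?_⟩
  ext x
  exact hD₀ X hX x

/-- A map derivable at `G ≠ 0` that is a left multiplication on the operators of finite rank
vanishes. -/
theorem IsDerivableAt.eq_zero {φ : (H →L[ℂ] H) →ₗ[ℂ] (H →L[ℂ] H)} {G : H →L[ℂ] H}
    (h : IsDerivableAt φ G) (hG : G ≠ 0) (hφ : ∀ X ∈ finiteRank H, φ X = φ 1 * X) : φ = 0 := by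
  have hsp := finiteRank_le_span_isIdempotentElem (H := H)
  have hc : φ 1 = 0 := by
    by_contra hne
    have h1 : ∀ x y, φ 1 * rankOne ℂ x y * G = 1 * rankOne ℂ x y * φ G := by
      intro x y
      have hm := rankOne_mem_finiteRank x y
      have := h.map_mul (hsp hm)
      rw [hφ _ hm, hφ _ (mul_mem_finiteRank_right G hm), ← mul_assoc, add_sub_cancel_left] at this
      rw [this, one_mul]
    obtain ⟨μ, h2, -⟩ := exists_smul_of_mul_rankOne_mul_eq hG h1
    have h3 := h.map_one_mul
    rw [h2, smul_one_mul, smul_eq_zero] at h3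
    rcases h3 with rfl | h3
    · exact hne (by rw [h2, zero_smul])
    · exact hG h3
  have hF : ∀ X ∈ finiteRank H, φ X = 0 := fun X hX => by rw [hφ X hX, hc, zero_mul]
  have hφG : φ G = 0 := by
    have : ∀ x y, rankOne ℂ x y * φ G = 0 := by
      intro x y
      have hm := rankOne_mem_finiteRank x y
      have := h.map_mul (hsp hm)
      rw [hF _ hm, hF _ (mul_mem_finiteRank_right G hm), hc] at this
      simpa using this.symm
    by_contra hne
    have h1 := eq_zero_of_mul_rankOne_mul_eq_zero (S := G) hne fun x y => by
      rw [mul_assoc, this, mul_zero]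
    exact hG h1
  have hunit : ∀ u : (H →L[ℂ] H)ˣ, φ u = 0 := by
    intro u
    have hST : (u : H →L[ℂ] H) * (↑u⁻¹ * G) = G := by simp
    have hne : (↑u⁻¹ * G : H →L[ℂ] H) ≠ 0 := by
      intro h0
      rw [h0, mul_zero] at hST
      exact hG hST.symm
    -- Balancing u·(u⁻¹G) gives φ(u)X(u⁻¹G) = uXφ(u⁻¹G), so both values are scaled by the same μ;
    -- the Leibniz rule then reads 0 = φ(G) = 2μG.
    obtain ⟨μ, h1, h2⟩ := exists_smul_of_mul_rankOne_mul_eq (S := φ u) (S' := u)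
      (T' := φ (↑u⁻¹ * G)) hne fun x y => by
        have hm := rankOne_mem_finiteRank x y
        have := h.balanced (hsp hm) hST
        rw [hF _ (mul_mem_finiteRank_left _ hm), hF _ (mul_mem_finiteRank_right _ hm)] at this
        simpa using this.symm
    have hu : (u : H →L[ℂ] H) ≠ 0 := by
      intro h0
      rw [h0, zero_mul] at hST
      exact hG hST.symm
    have h3 := h _ _ hST
    rw [hST, hφG, h2 hu, h1, smul_mul_assoc, mul_smul_comm, hST, ← two_smul ℂ, smul_smul] at h3
    have h4 := (smul_eq_zero.1 h3.symm).resolve_right hG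
    rw [h1, (mul_eq_zero.1 h4).resolve_left two_ne_zero, zero_smul]
  refine LinearMap.ext fun X => ?_
  -- X = z·1 − (z·1 − X) with z·1 − X invertible, and φ kills both terms.
  obtain ⟨z, hz⟩ : ∃ z : ℂ, z ∉ spectrum ℂ X := by
    by_contra! hall
    have hb := (spectrum.isCompact (𝕜 := ℂ) X).isBounded
    rw [Set.eq_univ_of_forall hall] at hb
    exact NormedSpace.unbounded_univ ℂ ℂ hb
  rw [spectrum.notMem_iff] at hz
  obtain ⟨u, hu⟩ := hz
  have h1 := hunit u
  rw [hu, map_sub, Algebra.algebraMap_eq_smul_one, map_smul, hc, smul_zero, zero_sub,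
    neg_eq_zero] at h1
  exact h1

theorem IsDerivableAt.isInnerDerivation [Nontrivial H]
    {φ : (H →L[ℂ] H) →ₗ[ℂ] (H →L[ℂ] H)} {G : H →L[ℂ] H}
    (h : IsDerivableAt φ G) (hG : G ≠ 0) : IsInnerDerivation φ := by
  obtain ⟨D, hD⟩ := exists_eq_mul_sub_mul
    (fun X hX Y hY => h.leibnizDefect_eq_zero hG (X := X) (Y := Y) hX hY)
  refine ⟨D, fun X => ?_⟩
  have hψ : ∀ X, (φ - LinearMap.mulRight ℂ D + LinearMap.mulLeft ℂ D) X =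
      φ X - (X * D - D * X) := by
    intro X
    simp only [LinearMap.add_apply, LinearMap.sub_apply, LinearMap.mulRight_apply,
      LinearMap.mulLeft_apply]
    abel
  have h0 : φ - LinearMap.mulRight ℂ D + LinearMap.mulLeft ℂ D = 0 := by
    refine IsDerivableAt.eq_zero (G := G) (fun S T hST => ?_) hG fun X hX => ?_
    · rw [hψ, hψ, hψ, h S T hST]
      noncomm_ring
    · have := hD X hX
      rw [unitalPart_apply] at this
      rw [hψ, hψ, ← this]
      simp
  have := hψ X
  rw [h0, LinearMap.zero_apply] at this
  exact sub_eq_zero.1 this.symm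

end Hilbert

end DerivablePoint

theorem theorem2p1 {H : Type*} [NormedAddCommGroup H] [InnerProductSpace ℂ H] [CompleteSpace H]
    [Nontrivial H] (G : H →L[ℂ] H) :
    (DerivablePoint.IsAllDerivablePoint ℂ G ↔ G ≠ 0) ∧
      (G ≠ 0 → ∀ φ : (H →L[ℂ] H) →ₗ[ℂ] (H →L[ℂ] H),
        DerivablePoint.IsDerivableAt φ G → DerivablePoint.IsInnerDerivation φ) := by
  refine ⟨⟨?_, fun hG φ hφ => ?_⟩, fun hG φ hφ => hφ.isInnerDerivation hG⟩
  · rintro h rfl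
    -- The identity map is derivable at 0, but its Leibniz rule at (1,1) would say 1 = 2.
    have := h LinearMap.id (fun S T hST => by simp [hST]) 1 1
    simp at this
  · obtain ⟨D, hD⟩ := hφ.isInnerDerivation hG
    intro S T
    rw [hD, hD, hD]
    noncomm_ring
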